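/- **Theorem.** Let $S$ be a finite semigroup with a regular maximal $\mathcal{J}$-class $J$ such that $\langle J\rangle = S$. Let $H$ be a maximal subgroup of $S$ contained in $J$, and let $i$ and $j$ be the numbers of $\mathcal{R}$-classes and of $\mathcal{L}$-classes of $J$, respectively. Write $\operatorname{rank} S=\min\{|A| : A\subseteq S,\ \langle A\rangle = S\}$. Then: 1. If $H$ is trivial or cyclic, then $\operatorname{rank} S=\max(i,j)$. 2. If $\operatorname{rank} H=2$, that is, the least number of elements generating the group $H$ is $2$ (in particular, if $H$ is isomorphic to the symmetric group $S_r$ with $r\ge 3$), then $$\operatorname{rank} S=\begin{cases}\max(i,j)+1 & \text{if } i=j \text{ and every } \mathcal{R}\text{-class and every } \mathcal{L}\text{-class of } J \text{ contains exactly one idempotent},\\ \max(i,j) & \text{otherwise.}\end{cases}$$ Here $J$ is maximal if no $\mathcal{J}$-class lies strictly above it, and regular if each of its elements $a$ satisfies $axa=a$ for some $x\in S$. The theorem holds for either of the following meanings of $\langle X\rangle$, used both in the hypothesis $\langle J\rangle=S$ and in the definition of $\operatorname{rank} S$: the set of all non-empty products of elements of $X$; or that set together with the zero element of $S$, if $S$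 has at least two elements and has a zero. -/

import Mathlib

namespace FiniteSemigroup

/-- `a ≤ b` in the preorder of `R`: `a ∈ b S¹`. -/
def RLE {S : Type*} [Semigroup S] (a b : S) : Prop :=
  ∃ x : WithOne S, (a : WithOne S) = (b : WithOne S) * x

/-- `a ≤ b` in the preorder of `L`: `a ∈ S¹ b`. -/
def LLE {S : Type*} [Semigroup S] (a b : S) : Prop :=
  ∃ x : WithOne S, (a : WithOne S) = x * (b : WithOne S)

/-- `a ≤ b` in the preorder of `J`: `a ∈ S¹ b S¹`. -/
def JLE {S : Type*} [Semigroup S] (a b : S) : Prop :=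
  ∃ x y : WithOne S, (a : WithOne S) = x * (b : WithOne S) * y

/-- The `R`-class of `a`. -/
def RClass {S : Type*} [Semigroup S] (a : S) : Set S := {b | RLE b a ∧ RLE a b}

/-- The `L`-class of `a`. -/
def LClass {S : Type*} [Semigroup S] (a : S) : Set S := {b | LLE b a ∧ LLE a b}

/-- The `J`-class of `a`. -/
def JClass {S : Type*} [Semigroup S] (a : S) : Set S := {b | JLE b a ∧ JLE a b}

def IsJClass {S : Type*} [Semigroup S] (J : Set S) : Prop := ∃ a : S, J = JClass a

/-- No `J`-class lies strictly above `J`. -/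
def IsMaximalJClass {S : Type*} [Semigroup S] (J : Set S) : Prop :=
  IsJClass J ∧ ∀ a ∈ J, ∀ b : S, JLE a b → JLE b a

/-- Every element of `J` is regular in `S`. -/
def IsRegularSet {S : Type*} [Semigroup S] (J : Set S) : Prop :=
  ∀ a ∈ J, ∃ x : S, a * x * a = a

/-- The set of `R`-classes of (elements of) `J`. -/
def rClasses {S : Type*} [Semigroup S] (J : Set S) : Set (Set S) := RClass '' J

/-- The set of `L`-classes of (elements of) `J`. -/
def lClasses {S : Type*} [Semigroup S] (J : Set S) : Set (Set S) := LClass '' J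

/-- `K` contains exactly one idempotent. -/
def HasUniqueIdempotent {S : Type*} [Semigroup S] (K : Set S) : Prop :=
  ∃! e : S, e ∈ K ∧ IsIdempotentElem e

/-- The subsemigroup `H` is a group under the multiplication of `S`
(its identity need not be an identity of `S`). -/
def IsSubgroup {S : Type*} [Semigroup S] (H : Subsemigroup S) : Prop :=
  ∃ e ∈ H, (∀ x ∈ H, e * x = x ∧ x * e = x) ∧ ∀ x ∈ H, ∃ y ∈ H, x * y = e ∧ y * x = e

/-- `H` is maximal, under inclusion, among all subgroups of `S`. -/
def IsMaximalSubgroup {S : Type*} [Semigroup S] (H : Subsemigroup S) : Prop :=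
  Maximal IsSubgroup H

/-- `z` is a zero of `S`, where, as usual, only a semigroup with at least two elements
is said to have a zero. -/
def IsZeroElement {S : Type*} [Semigroup S] (z : S) : Prop :=
  Nontrivial S ∧ ∀ x : S, z * x = z ∧ x * z = z

/-- The set of all non-empty products of elements of `X`. -/
def products {S : Type*} [Semigroup S] (X : Set S) : Set S :=
  (Subsemigroup.closure X : Set S)

/-- The set of all non-empty products of elements of `X`, together with the zero of `S`
if there is one. -/
def productsWithZero {S : Type*} [Semigroup S] (X : Set S) : Set S :=
  products X ∪ {z | IsZeroElement z}

/-- The least number of elements of a subset that generates `S`, where `gen X` is the part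
of `S` generated by `X`. -/
noncomputable def rank {S : Type*} (gen : Set S → Set S) : ℕ :=
  sInf {n : ℕ | ∃ A : Finset S, A.card = n ∧ gen (A : Set S) = Set.univ}

end FiniteSemigroup

/-! By maximality every factor of a product lying in J lies in J, and by stability the product keeps
the R-class of its first factor and the L-class of its last. So a generating set meets every R-class
and every L-class of J, and the rank is at least n = max(i, j) (`ncard_rClasses_le`,
`ncard_lClasses_le`).

For the upper bound, index the R-classes and the L-classes by the same n labels, with repetitions,
so that the labels s whose H-class (s, s) is a group form a set B dominating all labels
(`exists_dominating_pairs`). In Rees coordinates take one generator per label, arranged in a cycle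
along B. The product round the cycle is a prescribed group element g, and parts of the cycle link
the classes to each other. A label outside B leaves one free group entry, used to produce a second
element h (`exists_generators_of_coordinates`). Such a label can be arranged unless the idempotents
match R-classes with L-classes bijectively.

In that exceptional case, with one generator per R-class, each element of J has exactly one
generator that keeps it in J on the right. Words from an idempotent then follow a single path, whose
first return to H generates H (`isCyclic_of_ncard_le`). A noncyclic H therefore needs an extra
generator, and one is enough when H has two generators. -/

namespace FiniteSemigroup

/-! ### Stability of finite monoids -/

section Stability

variable {M : Type*} [Monoid M] [Finite M]

/-- Iterating gives a = x^m a y^m for all m; two powers of y coincide by finiteness, and the surplus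
power of y fixes a. -/
theorem exists_eq_mul_pow_right {a x y : M} (h : a = x * a * y) : ∃ n : ℕ, a = a * y ^ (n + 1) := by
  have key : ∀ n : ℕ, a = x ^ n * a * y ^ n := by
    intro n
    induction n with
    | zero => simp
    | succ n ih =>
      calc a = x ^ n * a * y ^ n := ih
        _ = x ^ n * (x * a * y) * y ^ n := by rw [← h]
        _ = _ := by rw [pow_succ x, pow_succ' y]; simp only [mul_assoc]
  obtain ⟨m, n, hmn, heq⟩ := Set.finite_univ.exists_lt_map_eq_of_forall_mem
    (f := fun n : ℕ => y ^ n) (fun _ => Set.mem_univ _)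
  obtain ⟨d, rfl⟩ := Nat.exists_eq_add_of_lt hmn
  refine ⟨d, ?_⟩
  calc a = x ^ m * a * y ^ m := key m
    _ = x ^ m * a * y ^ (m + d + 1) := by rw [show y ^ m = y ^ (m + d + 1) from heq]
    _ = (x ^ m * a * y ^ m) * y ^ (d + 1) := by rw [add_assoc, pow_add]; simp only [mul_assoc]
    _ = _ := by rw [← key m]

theorem exists_eq_mul_pow_left {a x y : M} (h : a = x * a * y) : ∃ n : ℕ, a = x ^ (n + 1) * a := by
  have : Finite Mᵐᵒᵖ := Finite.of_equiv M MulOpposite.opEquiv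
  have := exists_eq_mul_pow_right (M := Mᵐᵒᵖ) (a := .op a) (x := .op y) (y := .op x)
    (by rw [← MulOpposite.op_mul, ← MulOpposite.op_mul, ← mul_assoc, ← h])
  obtain ⟨n, hn⟩ := this
  exact ⟨n, by simpa using congrArg MulOpposite.unop hn⟩

end Stability

/-! ### Green's preorders and classes -/

variable {S : Type*} [Semigroup S]

instance [Finite S] : Finite (WithOne S) := inferInstanceAs (Finite (Option S))

theorem RLE.refl (a : S) : RLE a a := ⟨1, by simp⟩
theorem LLE.refl (a : S) : LLE a a := ⟨1, by simp⟩

theorem RLE.trans {a b c : S} : RLE a b → RLE b c → RLE a c := by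
  rintro ⟨x, hx⟩ ⟨y, hy⟩
  exact ⟨y * x, by rw [hx, hy, mul_assoc]⟩

theorem LLE.trans {a b c : S} : LLE a b → LLE b c → LLE a c := by
  rintro ⟨x, hx⟩ ⟨y, hy⟩
  exact ⟨x * y, by rw [hx, hy, mul_assoc]⟩

theorem JLE.trans {a b c : S} : JLE a b → JLE b c → JLE a c := by
  rintro ⟨x, x', hx⟩ ⟨y, y', hy⟩
  exact ⟨x * y, y' * x', by rw [hx, hy]; simp only [mul_assoc]⟩

theorem RLE.jLE {a b : S} : RLE a b → JLE a b := by
  rintro ⟨x, hx⟩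
  exact ⟨1, x, by simpa using hx⟩

theorem LLE.jLE {a b : S} : LLE a b → JLE a b := by
  rintro ⟨x, hx⟩
  exact ⟨x, 1, by simpa using hx⟩

theorem rLE_mul (a b : S) : RLE (a * b) a := ⟨b, by simp⟩
theorem lLE_mul (a b : S) : LLE (a * b) b := ⟨a, by simp⟩

theorem rClass_eq_iff {a b : S} : RClass a = RClass b ↔ RLE a b ∧ RLE b a := by
  constructor
  · intro h
    have : a ∈ RClass a := ⟨RLE.refl a, RLE.refl a⟩
    rw [h] at this
    exact this
  · rintro ⟨h1, h2⟩
    ext c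
    exact ⟨fun h => ⟨h.1.trans h1, h2.trans h.2⟩, fun h => ⟨h.1.trans h2, h1.trans h.2⟩⟩

theorem lClass_eq_iff {a b : S} : LClass a = LClass b ↔ LLE a b ∧ LLE b a := by
  constructor
  · intro h
    have : a ∈ LClass a := ⟨LLE.refl a, LLE.refl a⟩
    rw [h] at this
    exact this
  · rintro ⟨h1, h2⟩
    ext c
    exact ⟨fun h => ⟨h.1.trans h1, h2.trans h.2⟩, fun h => ⟨h.1.trans h2, h1.trans h.2⟩⟩

theorem mem_rClass_iff {a b : S} : a ∈ RClass b ↔ RClass a = RClass b := rClass_eq_iff.symm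
theorem mem_lClass_iff {a b : S} : a ∈ LClass b ↔ LClass a = LClass b := lClass_eq_iff.symm

theorem rLE_mul_of_jLE [Finite S] {a b : S} (h : JLE a (a * b)) : RLE a (a * b) := by
  obtain ⟨x, y, h⟩ := h
  obtain ⟨n, hn⟩ := exists_eq_mul_pow_right (M := WithOne S) (a := a) (x := x) (y := b * y)
    (by rw [WithOne.coe_mul] at h; simpa only [mul_assoc] using h)
  exact ⟨y * (b * y) ^ n, by rw [WithOne.coe_mul]; rw [pow_succ'] at hn; simpa only [mul_assoc] using hn⟩

theorem lLE_mul_of_jLE [Finite S] {a b : S} (h : JLE b (a * b)) : LLE b (a * b) := by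
  obtain ⟨x, y, h⟩ := h
  obtain ⟨n, hn⟩ := exists_eq_mul_pow_left (M := WithOne S) (a := b) (x := x * a) (y := y)
    (by rw [WithOne.coe_mul] at h; simpa only [mul_assoc] using h)
  exact ⟨(x * a) ^ n * x, by rw [WithOne.coe_mul]; rw [pow_succ] at hn; simpa only [mul_assoc] using hn⟩

theorem mul_eq_of_rLE_idempotent {e a : S} (he : IsIdempotentElem e) (h : RLE a e) : e * a = a := by
  obtain ⟨x, hx⟩ := h
  apply WithOne.coe_injective
  rw [WithOne.coe_mul, hx, ← mul_assoc, ← WithOne.coe_mul, he.eq]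

theorem mul_eq_of_lLE_idempotent {e a : S} (he : IsIdempotentElem e) (h : LLE a e) : a * e = a := by
  obtain ⟨x, hx⟩ := h
  apply WithOne.coe_injective
  rw [WithOne.coe_mul, hx, mul_assoc, ← WithOne.coe_mul, he.eq]

/-- A right unit c of b replaces the adjoined identity, so the multiplier can be taken in S itself.
-/
theorem RLE.exists_of_mul_eq {a b c : S} (h : RLE a b) (hc : b * c = b) : ∃ x, a = b * x := by
  obtain ⟨x, hx⟩ := h
  rw [← hc] at hx
  cases x with
  | one => exact ⟨c, WithOne.coe_injective (by simpa using hx)⟩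
  | coe x => exact ⟨c * x, WithOne.coe_injective (by simpa [mul_assoc] using hx)⟩

theorem LLE.exists_of_mul_eq {a b c : S} (h : LLE a b) (hc : c * b = b) : ∃ x, a = x * b := by
  obtain ⟨x, hx⟩ := h
  rw [← hc] at hx
  cases x with
  | one => exact ⟨c, WithOne.coe_injective (by simpa using hx)⟩
  | coe x => exact ⟨x * c, WithOne.coe_injective (by simpa [mul_assoc] using hx)⟩

/-! ### Maximal regular J-classes -/

section MaximalJClass

variable {J : Set S}

theorem IsMaximalJClass.mem_of_jLE (hJ : IsMaximalJClass J) {a b : S} (ha : a ∈ J)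
    (h : JLE a b) : b ∈ J := by
  have h' := hJ.2 a ha b h
  obtain ⟨⟨c, rfl⟩, -⟩ := hJ
  exact ⟨h'.trans ha.1, ha.2.trans h⟩

theorem IsMaximalJClass.jLE (hJ : IsMaximalJClass J) {a b : S} (ha : a ∈ J) (hb : b ∈ J) :
    JLE a b := by
  obtain ⟨⟨c, rfl⟩, -⟩ := hJ
  exact ha.1.trans hb.2

theorem IsMaximalJClass.left_mem (hJ : IsMaximalJClass J) {a b : S} (h : a * b ∈ J) : a ∈ J :=
  hJ.mem_of_jLE h (rLE_mul a b).jLE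

theorem IsMaximalJClass.right_mem (hJ : IsMaximalJClass J) {a b : S} (h : a * b ∈ J) : b ∈ J :=
  hJ.mem_of_jLE h (lLE_mul a b).jLE

theorem IsMaximalJClass.mem_of_rClass_eq (hJ : IsMaximalJClass J) {a b : S} (ha : a ∈ J)
    (h : RClass a = RClass b) : b ∈ J :=
  hJ.mem_of_jLE ha (rClass_eq_iff.1 h).1.jLE

theorem IsMaximalJClass.mem_of_lClass_eq (hJ : IsMaximalJClass J) {a b : S} (ha : a ∈ J)
    (h : LClass a = LClass b) : b ∈ J :=
  hJ.mem_of_jLE ha (lClass_eq_iff.1 h).1.jLE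

theorem IsMaximalJClass.rClass_mul [Finite S] (hJ : IsMaximalJClass J) {a b : S} (h : a * b ∈ J) :
    RClass (a * b) = RClass a :=
  rClass_eq_iff.2 ⟨rLE_mul a b, rLE_mul_of_jLE (hJ.jLE (hJ.left_mem h) h)⟩

theorem IsMaximalJClass.lClass_mul [Finite S] (hJ : IsMaximalJClass J) {a b : S} (h : a * b ∈ J) :
    LClass (a * b) = LClass b :=
  lClass_eq_iff.2 ⟨lLE_mul a b, lLE_mul_of_jLE (hJ.jLE (hJ.right_mem h) h)⟩

theorem IsRegularSet.exists_mul_eq (hreg : IsRegularSet J) {a b : S} (hb : b ∈ J)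
    (h : RClass a = RClass b) : ∃ x, a = b * x := by
  obtain ⟨y, hy⟩ := hreg b hb
  exact (rClass_eq_iff.1 h).1.exists_of_mul_eq (c := y * b) (by rw [← mul_assoc, hy])

theorem IsRegularSet.exists_eq_mul (hreg : IsRegularSet J) {a b : S} (hb : b ∈ J)
    (h : LClass a = LClass b) : ∃ x, a = x * b := by
  obtain ⟨y, hy⟩ := hreg b hb
  exact (lClass_eq_iff.1 h).1.exists_of_mul_eq (c := b * y) hy

/-- The equality J = D of finite semigroups: if a = x b y, then c = x b works by stability. -/
theorem IsMaximalJClass.exists_mem_inter [Finite S] (hJ : IsMaximalJClass J) {a b : S} (ha : a ∈ J)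
    (hb : b ∈ J) : ∃ c ∈ J, RClass c = RClass a ∧ LClass c = LClass b := by
  obtain ⟨x, y, h⟩ := hJ.jLE ha hb
  obtain ⟨c, hc⟩ : ∃ c : S, (c : WithOne S) = x * b := by
    cases x with
    | one => exact ⟨b, by simp⟩
    | coe x => exact ⟨x * b, by simp⟩
  rw [← hc] at h
  have hac : RLE a c := ⟨y, h⟩
  have hcJ : c ∈ J := hJ.mem_of_jLE ha hac.jLE
  refine ⟨c, hcJ, rClass_eq_iff.2 ⟨?_, hac⟩, ?_⟩
  · cases y with
    | one => exact ⟨1, by simpa using h.symm⟩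
    | coe y =>
      obtain rfl : a = c * y := WithOne.coe_injective (by simpa using h)
      exact (rClass_eq_iff.1 (hJ.rClass_mul ha)).2
  · cases x with
    | one => rw [WithOne.coe_injective (hc.trans (one_mul _))]
    | coe x =>
      obtain rfl : c = x * b := WithOne.coe_injective (by simpa using hc)
      exact hJ.lClass_mul hcJ

/-- Writing f = x a = b y gives f = f f = x (a b) y, so a b lies above f. Together with
`IsMaximalJClass.exists_idempotent` this is the Clifford–Miller criterion. -/
theorem IsMaximalJClass.mul_mem (hJ : IsMaximalJClass J) {a b f : S} (hf : f ∈ J)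
    (hfi : IsIdempotentElem f) (hfa : LClass f = LClass a) (hfb : RClass f = RClass b) :
    a * b ∈ J := by
  obtain ⟨x, hx⟩ := (lClass_eq_iff.1 hfa).1
  obtain ⟨y, hy⟩ := (rClass_eq_iff.1 hfb).1
  refine hJ.mem_of_jLE hf ⟨x, y, ?_⟩
  rw [← hfi.eq, WithOne.coe_mul]
  nth_rw 1 [hx]
  rw [hy, WithOne.coe_mul]
  simp only [mul_assoc]

/-- By stability a = a b u and b = v a b; then b u = v a is the required idempotent. -/
theorem IsMaximalJClass.exists_idempotent [Finite S] (hJ : IsMaximalJClass J) (hreg : IsRegularSet J)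
    {a b : S} (h : a * b ∈ J) :
    ∃ f ∈ J, IsIdempotentElem f ∧ LClass f = LClass a ∧ RClass f = RClass b := by
  obtain ⟨u, hu⟩ := hreg.exists_mul_eq h (hJ.rClass_mul h).symm
  obtain ⟨v, hv⟩ := hreg.exists_eq_mul h (hJ.lClass_mul h).symm
  have hvu : b * u = v * a := by
    conv_lhs => rw [hv]
    conv_rhs => rw [hu]
    simp only [mul_assoc]
  have hfb : b * u * b = b := by
    rw [hvu, mul_assoc, ← hv]
  have hfa : a * (b * u) = a := by rw [← mul_assoc, ← hu]
  refine ⟨b * u, hJ.mem_of_jLE (hJ.right_mem h) ⟨1, b, ?_⟩, ?_, ?_, ?_⟩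
  · rw [one_mul, ← WithOne.coe_mul, hfb]
  · rw [IsIdempotentElem, ← mul_assoc, hfb]
  · exact lClass_eq_iff.2 ⟨⟨v, by rw [hvu, WithOne.coe_mul]⟩,
      ⟨a, by rw [← WithOne.coe_mul, hfa]⟩⟩
  · exact rClass_eq_iff.2 ⟨rLE_mul b u, ⟨b, by rw [← WithOne.coe_mul, hfb]⟩⟩

theorem IsRegularSet.exists_idempotent_rClass (hJ : IsMaximalJClass J) (hreg : IsRegularSet J)
    {a : S} (ha : a ∈ J) : ∃ f ∈ J, IsIdempotentElem f ∧ RClass f = RClass a := by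
  obtain ⟨x, hx⟩ := hreg a ha
  have h : RClass (a * x) = RClass a :=
    rClass_eq_iff.2 ⟨rLE_mul a x, ⟨a, by rw [← WithOne.coe_mul, hx]⟩⟩
  exact ⟨a * x, hJ.mem_of_rClass_eq ha h.symm, by rw [IsIdempotentElem, ← mul_assoc, hx], h⟩

theorem IsRegularSet.exists_idempotent_lClass (hJ : IsMaximalJClass J) (hreg : IsRegularSet J)
    {a : S} (ha : a ∈ J) : ∃ f ∈ J, IsIdempotentElem f ∧ LClass f = LClass a := by
  obtain ⟨x, hx⟩ := hreg a ha
  have h : LClass (x * a) = LClass a :=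
    lClass_eq_iff.2 ⟨lLE_mul x a, ⟨a, by rw [← WithOne.coe_mul, ← mul_assoc, hx]⟩⟩
  refine ⟨x * a, hJ.mem_of_lClass_eq ha h.symm, ?_, h⟩
  rw [IsIdempotentElem, mul_assoc, ← mul_assoc a, hx]

theorem idempotent_eq_of_classes {e f : S} (he : IsIdempotentElem e) (hf : IsIdempotentElem f)
    (hR : RClass e = RClass f) (hL : LClass e = LClass f) : e = f := by
  rw [← mul_eq_of_rLE_idempotent hf (rClass_eq_iff.1 hR).1,
    mul_eq_of_lLE_idempotent he (lClass_eq_iff.1 hL).2]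

/-- The `H`-class of an idempotent is a subgroup. -/
theorem IsMaximalSubgroup.mem_iff {H : Subsemigroup S} (hH : IsMaximalSubgroup H) {e : S} (heH : e ∈ H)
    (he : IsIdempotentElem e) {x : S} :
    x ∈ H ↔ RClass x = RClass e ∧ LClass x = LClass e := by
  have hsub : ∀ x ∈ H, RClass x = RClass e ∧ LClass x = LClass e := by
    obtain ⟨e', he'H, h1, h2⟩ := hH.prop
    obtain rfl : e = e' := by
      obtain ⟨y, -, hy, -⟩ := h2 e heH
      rw [← hy]
      nth_rw 2 [← he.eq]
      rw [mul_assoc, hy, (h1 e heH).2]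
    intro x hx
    obtain ⟨y, -, hxy, hyx⟩ := h2 x hx
    refine ⟨rClass_eq_iff.2 ⟨⟨x, ?_⟩, ⟨y, ?_⟩⟩, lClass_eq_iff.2 ⟨⟨x, ?_⟩, ⟨y, ?_⟩⟩⟩
    · rw [← WithOne.coe_mul, (h1 x hx).1]
    · rw [← WithOne.coe_mul, hxy]
    · rw [← WithOne.coe_mul, (h1 x hx).2]
    · rw [← WithOne.coe_mul, hyx]
  refine ⟨hsub x, fun hx => ?_⟩
  have hright : ∀ x : S, LClass x = LClass e → x * e = x := fun x h =>
    mul_eq_of_lLE_idempotent he (lClass_eq_iff.1 h).1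
  have hleft : ∀ x : S, RClass x = RClass e → e * x = x := fun x h =>
    mul_eq_of_rLE_idempotent he (rClass_eq_iff.1 h).1
  let K : Subsemigroup S :=
    { carrier := {x | RClass x = RClass e ∧ LClass x = LClass e}
      mul_mem' := by
        rintro a b ⟨ha, ha'⟩ ⟨hb, hb'⟩
        obtain ⟨u, hu⟩ := (rClass_eq_iff.1 ha).2
        obtain ⟨v, hv⟩ := (rClass_eq_iff.1 hb).2
        obtain ⟨u', hu'⟩ := (lClass_eq_iff.1 ha').2
        obtain ⟨v', hv'⟩ := (lClass_eq_iff.1 hb').2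
        refine ⟨?_, ?_⟩
        · refine (rClass_eq_iff.2 ⟨rLE_mul a b, ⟨v, ?_⟩⟩).trans ha
          rw [WithOne.coe_mul, mul_assoc, ← hv, ← WithOne.coe_mul, hright a ha']
        · refine (lClass_eq_iff.2 ⟨lLE_mul a b, ⟨u', ?_⟩⟩).trans hb'
          rw [WithOne.coe_mul, ← mul_assoc, ← hu', ← WithOne.coe_mul, hleft b hb] }
  have hK : IsSubgroup K := by
    refine ⟨e, ⟨rfl, rfl⟩, fun x hx => ⟨hleft x hx.1, hright x hx.2⟩, ?_⟩
    rintro x ⟨hx, hx'⟩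
    obtain ⟨u, hu⟩ := (rClass_eq_iff.1 hx).2.exists_of_mul_eq (hright x hx')
    obtain ⟨w, hw⟩ := (lClass_eq_iff.1 hx').2.exists_of_mul_eq (hleft x hx)
    have hxu : x * (e * u * e) = e := by
      rw [← mul_assoc, ← mul_assoc, hright x hx', ← hu, he.eq]
    have hwx : (e * w * e) * x = e := by
      rw [mul_assoc, hleft x hx, mul_assoc, ← hw, he.eq]
    -- A left and a right inverse of the same element coincide.
    have hwu : e * w * e = e * u * e := by
      calc e * w * e = (e * w * e) * e := by rw [mul_assoc _ e e, he.eq]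
        _ = (e * w * e) * (x * (e * u * e)) := by rw [hxu]
        _ = e * (e * u * e) := by rw [← mul_assoc, hwx]
        _ = _ := by rw [← mul_assoc, ← mul_assoc, he.eq]
    rw [hwu] at hwx
    refine ⟨e * u * e, ⟨rClass_eq_iff.2 ⟨?_, ⟨x, ?_⟩⟩, lClass_eq_iff.2 ⟨lLE_mul _ _, ⟨x, ?_⟩⟩⟩,
      hxu, hwx⟩
    · rw [mul_assoc]; exact rLE_mul _ _
    · rw [← WithOne.coe_mul, hwx]
    · rw [← WithOne.coe_mul, hxu]
  exact hH.le_of_ge hK (fun x hx => hsub x hx) hx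

end MaximalJClass


/-! ### Pairing the classes; generators in coordinates -/

theorem exists_surjective_fin {Z : Type*} [Nonempty Z] [Finite Z] {n : ℕ} (h : Nat.card Z ≤ n) :
    ∃ f : Fin n → Z, f.Surjective := by
  have := Fintype.ofFinite Z
  obtain ⟨g⟩ : Nonempty (Z ↪ Fin n) := Function.Embedding.nonempty_of_card_le
    (by rwa [Fintype.card_fin, ← Nat.card_eq_fintype_card])
  exact ⟨Function.invFun g, Function.invFun_surjective g.injective⟩

/-- A relation between `X` and `Y` without isolated points admits a covering by `n` pairs together
with a nonempty set `B` of related pairs dominating everything; `B` can be taken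
proper unless the relation is a bijection. -/
theorem exists_dominating_pairs {X Y : Type*} [Nonempty X] [Finite X] [Finite Y]
    (P : Y → X → Prop) (hX : ∀ x, ∃ y, P y x) (hY : ∀ y, ∃ x, P y x) (n : ℕ)
    (hXn : Nat.card X ≤ n) (hYn : Nat.card Y ≤ n) :
    ∃ (ξ : Fin n → X) (η : Fin n → Y) (B : Finset (Fin n)),
      ξ.Surjective ∧ η.Surjective ∧ (∀ s ∈ B, P (η s) (ξ s)) ∧
      (∀ s, ∃ t ∈ B, P (η t) (ξ s)) ∧ (∀ s, ∃ t ∈ B, P (η s) (ξ t)) ∧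
      (B ≠ Finset.univ ∨ (Nat.card X = Nat.card Y ∧ (∀ x, ∃! y, P y x) ∧ ∀ y, ∃! x, P y x)) := by
  classical
  have : Nonempty Y := (hX (Classical.arbitrary X)).nonempty
  obtain ⟨ξ, hξ⟩ := exists_surjective_fin hXn
  have hsurjY := exists_surjective_fin hYn
  let good (η : Fin n → Y) : Finset (Fin n) := Finset.univ.filter fun s => P (η s) (ξ s)
  obtain ⟨η, hη, hmax⟩ := Set.exists_max_image {f : Fin n → Y | f.Surjective}
    (fun η => (good η).card) (Set.toFinite _) hsurjY
  -- If neither label were good, exchanging the values of η at s and t would make s good and spoil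
  -- nothing, against maximality.
  have hdom : ∀ s t, P (η t) (ξ s) → s ∈ good η ∨ t ∈ good η := by
    intro s t hst
    by_contra! hcon
    have hlt : good η ⊂ good (η ∘ Equiv.swap s t) := by
      refine Finset.ssubset_iff_of_subset (fun r hr => ?_) |>.2 ⟨s, by simp [good, hst], hcon.1⟩
      have h1 : r ≠ s := fun h => hcon.1 (h ▸ hr)
      have h2 : r ≠ t := fun h => hcon.2 (h ▸ hr)
      simpa [good, Equiv.swap_apply_of_ne_of_ne h1 h2] using hr
    exact absurd (hmax (η ∘ Equiv.swap s t) (hη.comp (Equiv.surjective _)))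
      (not_le.2 (Finset.card_lt_card hlt))
  have hgood : ∀ s ∈ good η, P (η s) (ξ s) := fun s hs => (Finset.mem_filter.1 hs).2
  have hdom1 : ∀ s, ∃ t ∈ good η, P (η t) (ξ s) := by
    intro s
    obtain ⟨y, hy⟩ := hX (ξ s)
    obtain ⟨t, rfl⟩ := hη y
    rcases hdom s t hy with h | h
    · exact ⟨s, h, hgood s h⟩
    · exact ⟨t, h, hy⟩
  have hdom2 : ∀ s, ∃ t ∈ good η, P (η s) (ξ t) := by
    intro s
    obtain ⟨x, hx⟩ := hY (η s)
    obtain ⟨t, rfl⟩ := hξ x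
    rcases hdom t s hx with h | h
    · exact ⟨t, h, hx⟩
    · exact ⟨s, h, hgood s h⟩
  by_cases hB : good η = Finset.univ
  swap
  · exact ⟨ξ, η, good η, hξ, hη, hgood, hdom1, hdom2, Or.inl hB⟩
  have hall : ∀ s, P (η s) (ξ s) := fun s => hgood s (hB ▸ Finset.mem_univ s)
  by_cases hex : ∃ s t, s ≠ t ∧ P (η s) (ξ t)
  · obtain ⟨s, t, hst, hP⟩ := hex
    -- Here every label is good and P has an extra related pair. After the exchange of ξ s and ξ t,
    -- the label s stays related to both values, so it dominates for t and t can be dropped from B.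
    have hs : s ∈ Finset.univ.erase t := by simp [hst]
    refine ⟨ξ ∘ Equiv.swap s t, η, Finset.univ.erase t, hξ.comp (Equiv.surjective _), hη,
      ?_, ?_, ?_, Or.inl fun h => by simpa using h.ge (Finset.mem_univ t)⟩
    · intro r hr
      by_cases h : r = s
      · subst h; simpa using hP
      · simpa [Equiv.swap_apply_of_ne_of_ne h (Finset.ne_of_mem_erase hr)] using hall r
    · intro r
      by_cases h : r = s
      · subst h; exact ⟨r, hs, by simpa using hP⟩
      by_cases h' : r = t
      · subst h'; exact ⟨s, hs, by simpa using hall s⟩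
      · exact ⟨r, by simp [h'], by simpa [Equiv.swap_apply_of_ne_of_ne h h'] using hall r⟩
    · intro r
      by_cases h : r = s
      · subst h; exact ⟨r, hs, by simpa using hP⟩
      by_cases h' : r = t
      · subst h'; exact ⟨s, hs, by simpa using hall r⟩
      · exact ⟨r, by simp [h'], by simpa [Equiv.swap_apply_of_ne_of_ne h h'] using hall r⟩
  · push Not at hex
    have huniq : ∀ s t, P (η s) (ξ t) → s = t := fun s t h => by
      by_contra hne
      exact hex s t hne h
    have hξi : ξ.Injective := fun s t h => huniq s t (h ▸ hall s)
    have hηi : η.Injective := fun s t h => huniq s t (h ▸ hall t)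
    refine ⟨ξ, η, good η, hξ, hη, hgood, hdom1, hdom2, Or.inr ⟨?_, ?_, ?_⟩⟩
    · rw [← Nat.card_eq_of_bijective ξ ⟨hξi, hξ⟩, Nat.card_eq_of_bijective η ⟨hηi, hη⟩]
    · intro x
      obtain ⟨t, rfl⟩ := hξ x
      refine ⟨η t, hall t, fun y hy => ?_⟩
      obtain ⟨s, rfl⟩ := hη y
      rw [huniq s t hy]
    · intro y
      obtain ⟨t, rfl⟩ := hη y
      refine ⟨ξ t, hall t, fun x hx => ?_⟩
      obtain ⟨s, rfl⟩ := hξ x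
      rw [huniq t s hx]

/-- Generating sets in coordinates `τ s k t` multiplying as in a Rees matrix semigroup with
sandwich matrix `p`, where `P` records the nonzero entries. -/
theorem exists_generators_of_coordinates {S G ι : Type*} [Semigroup S] [Group G] [Finite G]
    [Fintype ι] (τ : ι → G → ι → S) (P : ι → ι → Prop) (p : ι → ι → G)
    (hmul : ∀ s k t s' k' t', P t s' → τ s k t * τ s' k' t' = τ s (k * p t s' * k') t')
    (B : Finset ι) (hBP : ∀ b ∈ B, P b b) (hBp : ∀ b ∈ B, p b b = 1)
    (h1 : ∀ s, ∃ t ∈ B, P t s) (h2 : ∀ s, ∃ t ∈ B, P s t) (b : ι) (hb : b ∈ B) (g h : G) :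
    ∃ a : ι → S, ∀ T : Subsemigroup S, Set.range a ⊆ T → τ b g b ∈ T ∧
      (B ≠ Finset.univ → τ b h b ∈ T) ∧ ((∀ k, τ b k b ∈ T) → ∀ s k t, τ s k t ∈ T) := by
  classical
  obtain ⟨σ, hσ, hsupp⟩ := B.exists_cycleOn
  choose l hlB hlP using h1
  choose r hrB hrP using h2
  -- On the cycle only b carries g. Off B, the entry is chosen so that multiplying by `τ b 1 (l s)`
  -- on the left and `τ (r s) 1 b` on the right leaves exactly h.
  let κ : ι → G := fun s => if s ∈ B then (if s = b then g else 1) else (p (l s) s)⁻¹ * h * (p s (r s))⁻¹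
  have hσB : ∀ n : ℕ, (σ ^ n) b ∈ B := by
    intro n
    have := (hσ.1.perm_pow n).mapsTo hb
    exact this
  refine ⟨fun s => τ s (κ s) (σ s), fun T hT => ?_⟩
  have hTa : ∀ s, τ s (κ s) (σ s) ∈ T := fun s => hT ⟨s, rfl⟩
  have hB0 : 0 < B.card := Finset.card_pos.2 ⟨b, hb⟩
  have hfirst : ∀ n : ℕ, n < B.card → τ b g ((σ ^ (n + 1)) b) ∈ T := by
    intro n
    induction n with
    | zero => intro _; simpa [κ, hb] using hTa b
    | succ n ih =>
      intro hn
      have hne : (σ ^ (n + 1)) b ≠ b := fun h => by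
        have := Nat.le_of_dvd (by omega) ((hσ.pow_apply_eq hb).1 h)
        omega
      have hmem := T.mul_mem (ih (by omega)) (hTa ((σ ^ (n + 1)) b))
      rw [hmul _ _ _ _ _ _ (hBP _ (hσB _)), hBp _ (hσB _)] at hmem
      simp only [κ, hσB, hne, if_true, if_false, mul_one] at hmem
      rw [pow_succ' σ (n + 1)]
      exact hmem
  have hcard : (σ ^ B.card) b = b := (hσ.pow_apply_eq hb).2 dvd_rfl
  have hg : τ b g b ∈ T := by
    have := hfirst (B.card - 1) (by omega)
    rwa [Nat.sub_add_cancel hB0, hcard] at this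
  have hpow : ∀ n : ℕ, τ b (g ^ (n + 1)) b ∈ T := by
    intro n
    induction n with
    | zero => simpa using hg
    | succ n ih =>
      have := T.mul_mem ih hg
      rwa [hmul _ _ _ _ _ _ (hBP _ hb), hBp _ hb, mul_one, ← pow_succ] at this
  have hord := orderOf_pos g
  have hone : τ b 1 b ∈ T := by
    have := hpow (orderOf g - 1)
    rwa [Nat.sub_add_cancel hord, pow_orderOf_eq_one] at this
  have hinv : τ b g⁻¹ b ∈ T := by
    -- The exponent 2·ord(g) − 1 represents the inverse and stays positive even when g = 1; a
    -- subsemigroup offers only positive powers.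
    have := hpow (2 * orderOf g - 2)
    rwa [show 2 * orderOf g - 2 + 1 = (orderOf g - 1) + orderOf g by omega, pow_add,
      pow_orderOf_eq_one, mul_one, show g ^ (orderOf g - 1) = g⁻¹ from
        eq_inv_of_mul_eq_one_left (by rw [← pow_succ, Nat.sub_add_cancel hord, pow_orderOf_eq_one])]
      at this
  have hcover : ∀ t ∈ B, ∃ n < B.card, (σ ^ (n + 1)) b = t := by
    intro t ht
    obtain ⟨n, hn, rfl⟩ := hσ.exists_pow_eq hb ht
    rcases n with _ | n
    · exact ⟨B.card - 1, by omega, by rw [Nat.sub_add_cancel hB0, hcard]; simp⟩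
    · exact ⟨n, by omega, rfl⟩
  have hrow : ∀ t ∈ B, τ b 1 t ∈ T := by
    intro t ht
    obtain ⟨n, hn, rfl⟩ := hcover t ht
    have := T.mul_mem hinv (hfirst n hn)
    rwa [hmul _ _ _ _ _ _ (hBP _ hb), hBp _ hb, mul_one, inv_mul_cancel] at this
  have hcol : ∀ t ∈ B, τ t 1 b ∈ T := by
    -- d counts the steps left until the cycle closes at b; the tail of the cycle avoids g.
    have key : ∀ d n : ℕ, n + 1 + d = B.card → τ ((σ ^ (n + 1)) b) 1 b ∈ T := by
      intro d
      induction d with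
      | zero => intro n hn; rw [add_zero] at hn; rwa [hn, hcard]
      | succ d ih =>
        intro n hn
        have hne : (σ ^ (n + 1)) b ≠ b := fun h => by
          have := Nat.le_of_dvd (by omega) ((hσ.pow_apply_eq hb).1 h)
          omega
        have hmem := hTa ((σ ^ (n + 1)) b)
        simp only [κ, hσB, hne, if_true, if_false] at hmem
        rw [← Equiv.Perm.mul_apply, ← pow_succ' σ (n + 1)] at hmem
        have := T.mul_mem hmem (ih (n + 1) (by omega))
        rwa [hmul _ _ _ _ _ _ (hBP _ (hσB _)), hBp _ (hσB _), mul_one, mul_one] at this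
    intro t ht
    obtain ⟨n, hn, rfl⟩ := hcover t ht
    exact key (B.card - (n + 1)) n (by omega)
  have hfix : ∀ s ∉ B, σ s = s := by
    intro s hs
    by_contra hne
    exact hs (hsupp (Equiv.Perm.mem_support.2 hne))
  have hrow' : ∀ s ∉ B, τ b (p (l s) s * κ s) s ∈ T := by
    intro s hs
    have := T.mul_mem (hrow _ (hlB s)) (hTa s)
    rwa [hmul _ _ _ _ _ _ (hlP s), one_mul, hfix s hs] at this
  have hcol' : ∀ s ∉ B, τ s (κ s * p s (r s)) b ∈ T := by
    intro s hs
    have := T.mul_mem (hTa s) (hcol _ (hrB s))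
    rwa [hfix s hs, hmul _ _ _ _ _ _ (hrP s), mul_one] at this
  refine ⟨hg, fun hBne => ?_, fun hk s k t => ?_⟩
  · obtain ⟨s, hs⟩ : ∃ s, s ∉ B := by
      by_contra! hcon
      exact hBne (Finset.eq_univ_iff_forall.2 hcon)
    have := T.mul_mem (hrow' s hs) (hcol _ (hrB s))
    rw [hmul _ _ _ _ _ _ (hrP s), mul_one] at this
    simpa [κ, hs, mul_assoc] using this
  · have hrow'' : ∃ k', τ b k' t ∈ T := by
      by_cases ht : t ∈ B
      · exact ⟨_, hrow t ht⟩
      · exact ⟨_, hrow' t ht⟩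
    have hcol'' : ∃ k', τ s k' b ∈ T := by
      by_cases hs : s ∈ B
      · exact ⟨_, hcol s hs⟩
      · exact ⟨_, hcol' s hs⟩
    obtain ⟨k₁, hk₁⟩ := hrow''
    obtain ⟨k₂, hk₂⟩ := hcol''
    have := T.mul_mem (T.mul_mem hk₂ (hk (k₂⁻¹ * k * k₁⁻¹))) hk₁
    rw [hmul _ _ _ _ _ _ (hBP _ hb), hmul _ _ _ _ _ _ (hBP _ hb), hBp _ hb] at this
    simpa [mul_assoc] using this


/-- Every `R`-class and every `L`-class of `J` contains exactly one idempotent. -/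
def HasUniqueIdempotents {S : Type*} [Semigroup S] (J : Set S) : Prop :=
  (∀ K ∈ rClasses J, HasUniqueIdempotent K) ∧ ∀ K ∈ lClasses J, HasUniqueIdempotent K

/-- A subsemigroup containing the image of a generating set of a finite group contains the image
of the group. -/
theorem forall_mem_of_closure_eq_top {S G : Type*} [Semigroup S] [Group G] [Finite G] {ψ : G → S} (hψ : ∀ k k', ψ k * ψ k' = ψ (k * k'))
    {X : Set G} (hne : X.Nonempty) (hX : Subgroup.closure X = ⊤) {T : Subsemigroup S}
    (hT : ∀ x ∈ X, ψ x ∈ T) (k : G) : ψ k ∈ T := by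
  have hpow : ∀ x, ψ x ∈ T → ∀ n : ℕ, ψ (x ^ (n + 1)) ∈ T := by
    intro x hx n
    induction n with
    | zero => simpa using hx
    | succ n ih => rw [pow_succ, ← hψ]; exact T.mul_mem ih hx
  have hk : k ∈ Subgroup.closure X := hX ▸ Subgroup.mem_top k
  induction hk using Subgroup.closure_induction with
  | mem x hx => exact hT x hx
  | one =>
    obtain ⟨x, hx⟩ := hne
    have := hpow x (hT x hx) (orderOf x - 1)
    rwa [Nat.sub_add_cancel (orderOf_pos x), pow_orderOf_eq_one] at this
  | mul x y _ _ hx hy => rw [← hψ]; exact T.mul_mem hx hy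
  | inv x _ hx =>
    have := hpow x hx (2 * orderOf x - 2)
    have hpos := orderOf_pos x
    rwa [show 2 * orderOf x - 2 + 1 = (orderOf x - 1) + orderOf x by omega, pow_add,
      pow_orderOf_eq_one, mul_one, show x ^ (orderOf x - 1) = x⁻¹ from
        eq_inv_of_mul_eq_one_left (by rw [← pow_succ, Nat.sub_add_cancel hpos, pow_orderOf_eq_one])]
      at this

/-! ### Rees coordinates on J and its generators -/

section

variable {S : Type*} [Semigroup S] {J : Set S}

theorem hasUniqueIdempotents_of_existsUnique
    (hR : ∀ x : rClasses J, ∃! y : lClasses J, ∃ f ∈ J, IsIdempotentElem f ∧ LClass f = y ∧ RClass f = x)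
    (hL : ∀ y : lClasses J, ∃! x : rClasses J, ∃ f ∈ J, IsIdempotentElem f ∧ LClass f = y ∧ RClass f = x)
    (hJ : IsMaximalJClass J) : HasUniqueIdempotents J := by
  constructor
  · rintro _ ⟨a, ha, rfl⟩
    obtain ⟨y, ⟨f, hfJ, hf, hfy, hfx⟩, hy⟩ := hR ⟨RClass a, a, ha, rfl⟩
    refine ⟨f, ⟨mem_rClass_iff.2 hfx, hf⟩, ?_⟩
    rintro f' ⟨hfx', hf'⟩
    rw [mem_rClass_iff] at hfx'
    have hfJ' : f' ∈ J := hJ.mem_of_rClass_eq ha hfx'.symm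
    have := hy ⟨LClass f', f', hfJ', rfl⟩ ⟨f', hfJ', hf', rfl, hfx'⟩
    exact idempotent_eq_of_classes hf' hf (hfx'.trans hfx.symm)
      ((congrArg Subtype.val this).trans hfy.symm)
  · rintro _ ⟨a, ha, rfl⟩
    obtain ⟨x, ⟨f, hfJ, hf, hfy, hfx⟩, hx⟩ := hL ⟨LClass a, a, ha, rfl⟩
    refine ⟨f, ⟨mem_lClass_iff.2 hfy, hf⟩, ?_⟩
    rintro f' ⟨hfy', hf'⟩
    rw [mem_lClass_iff] at hfy'
    have hfJ' : f' ∈ J := hJ.mem_of_lClass_eq ha hfy'.symm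
    have := hx ⟨RClass f', f', hfJ', rfl⟩ ⟨f', hfJ', hf', hfy', rfl⟩
    exact idempotent_eq_of_classes hf' hf ((congrArg Subtype.val this).trans hfx.symm)
      (hfy'.trans hfy.symm)

variable [Finite S] {H : Subsemigroup S} {G : Type*} [Group G]

/-- Pick v in the R-class of e and the L-class of f, write e = v w, and trim w to u = f w e. This
normalizes the sandwich entries on B to 1. -/
theorem exists_inverse_pair (hJ : IsMaximalJClass J) (hreg : IsRegularSet J) {e : S} (he : e ∈ J)
    {f : S} (hf : f ∈ J) (hfi : IsIdempotentElem f) (hei : IsIdempotentElem e) :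
    ∃ u v : S, u ∈ J ∧ v ∈ J ∧ RClass u = RClass f ∧ LClass u = LClass e ∧
      RClass v = RClass e ∧ LClass v = LClass f ∧ v * u = e := by
  obtain ⟨v, hv, hvR, hvL⟩ := hJ.exists_mem_inter he hf
  obtain ⟨w, hw⟩ := hreg.exists_mul_eq hv hvR.symm
  have hvf : v * f = v := mul_eq_of_lLE_idempotent hfi (lClass_eq_iff.1 hvL).1
  have hvu : v * (f * w * e) = e := by
    rw [← mul_assoc, ← mul_assoc, hvf, ← hw, hei.eq]
  have hu : f * w * e ∈ J := hJ.right_mem (hvu.symm ▸ he)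
  refine ⟨f * w * e, v, hu, hv, ?_, hJ.lClass_mul hu, hvR, hvL, hvu⟩
  rw [mul_assoc] at hu ⊢
  exact hJ.rClass_mul hu

/-- The Rees coordinates attached to representatives `u s`, `v t` of the `R`- and `L`-classes. -/
theorem exists_mul_mul_eq (hJ : IsMaximalJClass J) (hreg : IsRegularSet J)
    (hH : IsMaximalSubgroup H) {e : S} (heH : e ∈ H) (he : IsIdempotentElem e)
    {u v x : S} (huL : LClass u = LClass e) (hvR : RClass v = RClass e) (hx : x ∈ J)
    (hxu : RClass x = RClass u) (hxv : LClass x = LClass v) : ∃ k ∈ H, x = u * k * v := by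
  have hu : u ∈ J := hJ.mem_of_rClass_eq hx hxu
  have hv : v ∈ J := hJ.mem_of_lClass_eq hx hxv
  obtain ⟨u', hu'⟩ := hreg.exists_eq_mul hu huL.symm
  obtain ⟨v', hv'⟩ := hreg.exists_mul_eq hv hvR.symm
  obtain ⟨z, hz⟩ := hreg.exists_mul_eq hu hxu
  obtain ⟨w, hw⟩ := hreg.exists_eq_mul hv hxv
  have hue : u * e = u := mul_eq_of_lLE_idempotent he (lClass_eq_iff.1 huL).1
  have hve : e * v = v := mul_eq_of_rLE_idempotent he (rClass_eq_iff.1 hvR).1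
  have hkx : u * (u' * x * v') * v = x := by
    have h1 : u * (u' * x) = x := by
      rw [hz, ← mul_assoc u', ← hu', ← mul_assoc, hue]
    have h2 : x * v' * v = x := by
      rw [hw, mul_assoc w, ← hv', mul_assoc, hve]
    rw [← mul_assoc u, h1, h2]
  have hk : u' * x * v' ∈ J := hJ.right_mem (hJ.left_mem (hkx.symm ▸ hx))
  refine ⟨u' * x * v', (hH.mem_iff heH he).2 ⟨?_, ?_⟩, hkx.symm⟩
  · have h : u' * x * v' = e * (z * v') := by
      rw [hz, ← mul_assoc, ← hu', mul_assoc]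
    rw [h] at hk ⊢
    exact hJ.rClass_mul hk
  · have h : u' * x * v' = u' * w * e := by
      rw [hw, hv']; simp only [mul_assoc]
    rw [h] at hk ⊢
    exact hJ.lClass_mul hk

/-- For all `g` and `h` in the maximal subgroup there are `n` elements of `J`, `n` bounding the
numbers of `R`- and `L`-classes, that generate (a copy of) `g`, generate `h` too unless
`J` is of Brandt type, and generate `J` once they generate the whole group. -/
theorem exists_generators [Finite G] (hJ : IsMaximalJClass J) (hreg : IsRegularSet J)
    (hH : IsMaximalSubgroup H) (hHJ : (H : Set S) ⊆ J) (φ : G ≃* H) {n : ℕ}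
    (hR : (rClasses J).ncard ≤ n) (hL : (lClasses J).ncard ≤ n) (g h : G) :
    ∃ (A : Finset S) (ψ : G → S), A.card ≤ n ∧ (∀ k k', ψ k * ψ k' = ψ (k * k')) ∧
      ∀ T : Subsemigroup S, (A : Set S) ⊆ T → ψ g ∈ T ∧
        (¬ ((rClasses J).ncard = (lClasses J).ncard ∧ HasUniqueIdempotents J) → ψ h ∈ T) ∧
        ((∀ k, ψ k ∈ T) → J ⊆ T) := by
  classical
  set e : S := ((φ 1 : H) : S) with he_def
  have heH : e ∈ H := (φ 1).2
  have heJ : e ∈ J := hHJ heH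
  have he : IsIdempotentElem e := by
    rw [IsIdempotentElem, he_def, ← MulMemClass.coe_mul, ← map_mul, mul_one]
  have : Nonempty (rClasses J) := ⟨⟨RClass e, e, heJ, rfl⟩⟩
  obtain ⟨ξ, η, B, hξ, hη, hB, hB1, hB2, hBr⟩ := exists_dominating_pairs
    (X := rClasses J) (Y := lClasses J)
    (fun y x => ∃ f ∈ J, IsIdempotentElem f ∧ LClass f = y ∧ RClass f = x)
    (by
      rintro ⟨_, a, ha, rfl⟩
      obtain ⟨f, hf, hfi, hfa⟩ := hreg.exists_idempotent_rClass hJ ha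
      exact ⟨⟨LClass f, f, hf, rfl⟩, f, hf, hfi, rfl, hfa⟩)
    (by
      rintro ⟨_, a, ha, rfl⟩
      obtain ⟨f, hf, hfi, hfa⟩ := hreg.exists_idempotent_lClass hJ ha
      exact ⟨⟨RClass f, f, hf, rfl⟩, f, hf, hfi, hfa, rfl⟩)
    n (by rwa [Nat.card_coe_set_eq]) (by rwa [Nat.card_coe_set_eq])
  have huv : ∀ s, ∃ u v : S, u ∈ J ∧ v ∈ J ∧ RClass u = ξ s ∧ LClass u = LClass e ∧
      RClass v = RClass e ∧ LClass v = η s ∧ (s ∈ B → v * u = e) := by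
    intro s
    by_cases hs : s ∈ B
    · obtain ⟨f, hf, hfi, hfy, hfx⟩ := hB s hs
      obtain ⟨u, v, hu, hv, h1, h2, h3, h4, h5⟩ := exists_inverse_pair hJ hreg heJ hf hfi he
      exact ⟨u, v, hu, hv, h1.trans hfx, h2, h3, h4.trans hfy, fun _ => h5⟩
    · obtain ⟨a, ha, hax⟩ := (ξ s).2
      obtain ⟨c, hc, hcy⟩ := (η s).2
      obtain ⟨u, hu, h1, h2⟩ := hJ.exists_mem_inter ha heJ
      obtain ⟨v, hv, h3, h4⟩ := hJ.exists_mem_inter heJ hc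
      exact ⟨u, v, hu, hv, h1.trans hax, h2, h3, h4.trans hcy, fun h => absurd h hs⟩
  choose u v hu hv huR huL hvR hvL hvu using huv
  have hp : ∀ t s, ∃ c : G, v t * u s ∈ J → v t * u s = φ c := by
    intro t s
    by_cases hts : v t * u s ∈ J
    · have hmem : v t * u s ∈ H := (hH.mem_iff heH he).2
        ⟨(hJ.rClass_mul hts).trans (hvR t), (hJ.lClass_mul hts).trans (huL s)⟩
      exact ⟨φ.symm ⟨_, hmem⟩, fun _ => by rw [φ.apply_symm_apply]⟩
    · exact ⟨1, fun h => absurd h hts⟩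
  choose p hp using hp
  have hPJ : ∀ t s, (∃ f ∈ J, IsIdempotentElem f ∧ LClass f = η t ∧ RClass f = ξ s) →
      v t * u s ∈ J := by
    rintro t s ⟨f, hf, hfi, hfy, hfx⟩
    exact hJ.mul_mem hf hfi (hfy.trans (hvL t).symm) (hfx.trans (huR s).symm)
  have hpB : ∀ b ∈ B, p b b = 1 := by
    intro b hb
    apply φ.injective
    apply Subtype.ext
    rw [← hp b b (hPJ b b (hB b hb)), hvu b hb]
  obtain ⟨b, hb, -⟩ := hB1 (hξ (Classical.arbitrary _)).choose
  obtain ⟨a, ha⟩ := exists_generators_of_coordinates (fun s (k : G) t => u s * φ k * v t)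
    (fun t s => v t * u s ∈ J) p
    (by
      intro s k t s' k' t' hts
      calc u s * φ k * v t * (u s' * φ k' * v t')
          = u s * (φ k * (v t * u s') * φ k') * v t' := by simp only [mul_assoc]
        _ = _ := by rw [hp t s' hts, map_mul, map_mul, MulMemClass.coe_mul, MulMemClass.coe_mul])
    B (fun b hb => hPJ b b (hB b hb)) hpB
    (fun s => (hB1 s).imp fun t ht => ⟨ht.1, hPJ _ _ ht.2⟩)
    (fun s => (hB2 s).imp fun t ht => ⟨ht.1, hPJ _ _ ht.2⟩) b hb g h
  refine ⟨Finset.univ.image a, fun k => u b * φ k * v b, ?_, ?_, ?_⟩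
  · exact Finset.card_image_le.trans (by simp)
  · intro k k'
    have h1 : v b * u b = ((φ 1 : H) : S) := hvu b hb
    calc u b * φ k * v b * (u b * φ k' * v b)
        = u b * (φ k * (v b * u b) * φ k') * v b := by simp only [mul_assoc]
      _ = u b * ((φ (k * 1 * k') : H) : S) * v b := by
        rw [h1, map_mul, map_mul, MulMemClass.coe_mul, MulMemClass.coe_mul]
      _ = _ := by rw [mul_one]
  · intro T hT
    obtain ⟨hg, hh, hall⟩ := ha T (by simpa using hT)
    refine ⟨hg, fun hne => hh ?_, fun hk x hx => ?_⟩
    · rcases hBr with hBr | ⟨h1, h2, h3⟩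
      · exact hBr
      · rw [Nat.card_coe_set_eq, Nat.card_coe_set_eq] at h1
        exact absurd ⟨h1, hasUniqueIdempotents_of_existsUnique h2 h3 hJ⟩ hne
    · obtain ⟨s, hs⟩ := hξ ⟨RClass x, x, hx, rfl⟩
      obtain ⟨t, ht⟩ := hη ⟨LClass x, x, hx, rfl⟩
      obtain ⟨k, hkH, rfl⟩ := exists_mul_mul_eq hJ hreg hH heH he (huL s) (hvR t) hx
        (by rw [huR, hs]) (by rw [hvL, ht])
      simpa using hall hk s (φ.symm ⟨k, hkH⟩) t

/-! ### Lower bounds for generating sets -/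

section LowerBounds

variable {A : Set S}

theorem exists_mem_rClass_eq (hJ : IsMaximalJClass J) {x : S} (hx : x ∈ Subsemigroup.closure A)
    (hxJ : x ∈ J) : ∃ a ∈ A, RClass a = RClass x := by
  induction hx using Subsemigroup.closure_induction with
  | mem x hx => exact ⟨x, hx, rfl⟩
  | mul x y _ _ ihx _ =>
    obtain ⟨a, ha, hax⟩ := ihx (hJ.left_mem hxJ)
    exact ⟨a, ha, hax.trans (hJ.rClass_mul hxJ).symm⟩

theorem exists_mem_lClass_eq (hJ : IsMaximalJClass J) {x : S} (hx : x ∈ Subsemigroup.closure A)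
    (hxJ : x ∈ J) : ∃ a ∈ A, LClass a = LClass x := by
  induction hx using Subsemigroup.closure_induction with
  | mem x hx => exact ⟨x, hx, rfl⟩
  | mul x y _ _ _ ihy =>
    obtain ⟨a, ha, hay⟩ := ihy (hJ.right_mem hxJ)
    exact ⟨a, ha, hay.trans (hJ.lClass_mul hxJ).symm⟩

theorem rClasses_subset_image (hJ : IsMaximalJClass J) (hA : J ⊆ Subsemigroup.closure A) :
    rClasses J ⊆ RClass '' A := by
  rintro _ ⟨x, hx, rfl⟩
  exact exists_mem_rClass_eq hJ (hA hx) hx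

theorem lClasses_subset_image (hJ : IsMaximalJClass J) (hA : J ⊆ Subsemigroup.closure A) :
    lClasses J ⊆ LClass '' A := by
  rintro _ ⟨x, hx, rfl⟩
  exact exists_mem_lClass_eq hJ (hA hx) hx

theorem ncard_rClasses_le (hJ : IsMaximalJClass J) (hA : J ⊆ Subsemigroup.closure A) :
    (rClasses J).ncard ≤ A.ncard :=
  (Set.ncard_le_ncard (rClasses_subset_image hJ hA) (Set.toFinite _)).trans
    (Set.ncard_image_le (Set.toFinite _))

theorem ncard_lClasses_le (hJ : IsMaximalJClass J) (hA : J ⊆ Subsemigroup.closure A) :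
    (lClasses J).ncard ≤ A.ncard :=
  (Set.ncard_le_ncard (lClasses_subset_image hJ hA) (Set.toFinite _)).trans
    (Set.ncard_image_le (Set.toFinite _))

/-- If every `R`-class and every `L`-class of `J` contains one idempotent only and `J` is generated
by one element per `R`-class, then the words over the generators that stay in `J` extend
uniquely, and the maximal subgroup is cyclic. -/
theorem isCyclic_of_ncard_le (hJ : IsMaximalJClass J) (hreg : IsRegularSet J)
    (hH : IsMaximalSubgroup H) (hHJ : (H : Set S) ⊆ J) (φ : G ≃* H)
    (huniq : HasUniqueIdempotents J) (hA : J ⊆ Subsemigroup.closure A)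
    (hcard : A.ncard ≤ (rClasses J).ncard) : IsCyclic G := by
  classical
  have hinj : Set.InjOn RClass A := by
    refine Set.injOn_of_ncard_image_eq (le_antisymm (Set.ncard_image_le (Set.toFinite _)) ?_)
      (Set.toFinite _)
    exact hcard.trans (Set.ncard_le_ncard (rClasses_subset_image hJ hA) (Set.toFinite _))
  set e : S := ((φ 1 : H) : S) with he_def
  have heH : e ∈ H := (φ 1).2
  have heJ : e ∈ J := hHJ heH
  have he : IsIdempotentElem e := by
    rw [IsIdempotentElem, he_def, ← MulMemClass.coe_mul, ← map_mul, mul_one]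
  have hleft : ∀ x : S, RClass x = RClass e → e * x = x := fun x h =>
    mul_eq_of_rLE_idempotent he (rClass_eq_iff.1 h).1
  have hext : ∀ x ∈ J, ∃ a ∈ A, x * a ∈ J := by
    intro x hx
    obtain ⟨f, hf, hfi, hfx⟩ := hreg.exists_idempotent_lClass hJ hx
    obtain ⟨a, ha, hfa⟩ := exists_mem_rClass_eq hJ (hA hf) hf
    exact ⟨a, ha, hJ.mul_mem hf hfi hfx hfa.symm⟩
  -- Two admissible generators give idempotents in the L-class of x, which coincide; the generators
  -- then share an R-class and `hinj` identifies them.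
  have hext_unique : ∀ x ∈ J, ∀ a ∈ A, ∀ b ∈ A, x * a ∈ J → x * b ∈ J → a = b := by
    intro x hx a ha b hb hxa hxb
    obtain ⟨f, -, hfi, hfx, hfa⟩ := hJ.exists_idempotent hreg hxa
    obtain ⟨f', -, hfi', hfx', hfb⟩ := hJ.exists_idempotent hreg hxb
    obtain rfl : f = f' := (huniq.2 (LClass x) ⟨x, hx, rfl⟩).unique
      ⟨mem_lClass_iff.2 hfx, hfi⟩ ⟨mem_lClass_iff.2 hfx', hfi'⟩
    exact hinj ha hb (hfa.symm.trans hfb)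
  choose! next hnextA hnextJ using hext
  -- The forced path starting at e.
  let w : ℕ → S := fun n => Nat.rec e (fun _ x => x * next x) n
  have hw0 : w 0 = e := rfl
  have hws : ∀ n, w (n + 1) = w n * next (w n) := fun n => rfl
  have hwJ : ∀ n, w n ∈ J := by
    intro n
    induction n with
    | zero => exact heJ
    | succ n ih => exact hnextJ _ ih
  have hwR : ∀ n, RClass (w n) = RClass e := by
    intro n
    induction n with
    | zero => rfl
    | succ n ih => rw [hws, hJ.rClass_mul (hws n ▸ hwJ (n + 1)), ih]
  have hword : ∀ x ∈ Subsemigroup.closure A, ∀ n, w n * x ∈ J → ∃ m, w n * x = w m := by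
    intro x hx
    induction hx using Subsemigroup.closure_induction with
    | mem a ha =>
      intro n hn
      refine ⟨n + 1, ?_⟩
      rw [hws, hext_unique _ (hwJ n) a ha _ (hnextA _ (hwJ n)) hn (hnextJ _ (hwJ n))]
    | mul x y _ _ ihx ihy =>
      intro n hn
      rw [← mul_assoc] at hn ⊢
      obtain ⟨m, hm⟩ := ihx n (hJ.left_mem hn)
      rw [hm] at hn ⊢
      exact ihy m hn
  have hHw : ∀ x ∈ H, ∃ m, x = w m := by
    intro x hx
    have hex : e * x = x := hleft x ((hH.mem_iff heH he).1 hx).1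
    obtain ⟨m, hm⟩ := hword x (hA (hHJ hx)) 0 (by rw [hw0, hex]; exact hHJ hx)
    exact ⟨m, by rw [← hm, hw0, hex]⟩
  have hφe : ∀ k : G, (φ k : S) = e → k = 1 := fun k hk => φ.injective (Subtype.ext hk)
  by_cases hret : ∃ N, w (N + 1) ∈ H
  swap
  · push Not at hret
    have htriv : ∀ k : G, k = 1 := by
      intro k
      obtain ⟨m, hm⟩ := hHw _ (φ k).2
      cases m with
      | zero => exact hφe k hm
      | succ m => exact absurd (hm ▸ (φ k).2) (hret m)
    have : Subsingleton G := ⟨fun a b => (htriv a).trans (htriv b).symm⟩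
    infer_instance
  set N := Nat.find hret with hN
  have hNH : w (N + 1) ∈ H := Nat.find_spec hret
  set g : G := φ.symm ⟨_, hNH⟩ with hg
  have hφg : (φ g : S) = w (N + 1) := by rw [hg, φ.apply_symm_apply]
  have hgJ : ∀ n, (φ g : S) * w n ∈ J := fun n =>
    hJ.mul_mem heJ he ((hH.mem_iff heH he).1 (φ g).2).2.symm (hwR n).symm
  have hge : ∀ k : G, (φ k : S) * e = φ k := fun k => by
    rw [he_def, ← MulMemClass.coe_mul, ← map_mul, mul_one]
  -- After the return the path repeats, translated by φ g: the generator admissible at w n is also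
  -- admissible at φ g · w n, hence is the one chosen there.
  have hshift : ∀ n, w (N + 1 + n) = φ g * w n := by
    intro n
    induction n with
    | zero => rw [add_zero, hw0, hge, hφg]
    | succ n ih =>
      have h1 : (φ g : S) * w n * next (w n) ∈ J := by
        rw [mul_assoc, ← hws]; exact hgJ (n + 1)
      rw [← add_assoc, hws (N + 1 + n), ih, hws n, ← mul_assoc,
        hext_unique _ (hgJ n) _ (hnextA _ (hgJ n)) _ (hnextA _ (hwJ n)) (hnextJ _ (hgJ n)) h1]
  have hpow : ∀ m, ∀ k : G, (φ k : S) = w m → k ∈ Subgroup.zpowers g := by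
    intro m
    induction m using Nat.strong_induction_on with
    | _ m ih =>
      intro k hk
      rcases m with _ | m
      · rw [hφe k hk]; exact Subgroup.one_mem _
      -- N + 1 is the first return time, so one factor g can be split off, leaving an earlier point
      -- of the path.
      · have hle : N ≤ m := Nat.find_min' hret (hk ▸ (φ k).2)
        obtain ⟨d, rfl⟩ := Nat.exists_eq_add_of_le hle
        have hk' : (φ (g⁻¹ * k) : S) = w d := by
          rw [map_mul, MulMemClass.coe_mul, hk, show N + d + 1 = N + 1 + d by omega, hshift,
            ← mul_assoc, ← MulMemClass.coe_mul, ← map_mul, inv_mul_cancel, ← he_def,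
            hleft _ (hwR d)]
        have := ih d (by omega) _ hk'
        exact (Subgroup.mul_mem_cancel_left _ (Subgroup.inv_mem _ (Subgroup.mem_zpowers g))).1 this
  refine ⟨g, fun k => ?_⟩
  obtain ⟨m, hm⟩ := hHw _ (φ k).2
  exact hpow m k hm

end LowerBounds

end

/-! ### Reduction of the rank to generating J -/

section Rank

variable {S : Type*} [Semigroup S] {J : Set S} {gen : Set S → Set S}

/-- The zero makes no difference: it lies below every element, so if it were in the maximal class J,
every element would equal it, while a zero presupposes two elements. -/
theorem gen_eq_univ_iff (hgen : gen = products ∨ gen = productsWithZero)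
    (hJ : IsMaximalJClass J) (hJgen : gen J = Set.univ) (A : Set S) :
    gen A = Set.univ ↔ J ⊆ Subsemigroup.closure A := by
  have hmono : J ⊆ Subsemigroup.closure A → products J ⊆ products A := fun h =>
    SetLike.coe_subset_coe.2 (Subsemigroup.closure_le.2 h)
  rcases hgen with rfl | rfl
  · refine ⟨fun h => ?_, fun h => ?_⟩
    · exact h.ge.trans' (Set.subset_univ J)
    · exact Set.eq_univ_of_univ_subset (hJgen.ge.trans (hmono h))
  · refine ⟨fun h x hx => ?_, fun h => ?_⟩
    · rcases h.ge (Set.mem_univ x) with hxA | ⟨hnt, hx0⟩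
      · exact hxA
      · exfalso
        have hJle : ∀ y, JLE x y := fun y => ⟨x, 1, by
          rw [mul_one, ← WithOne.coe_mul, (hx0 y).1]⟩
        have hzero : ∀ y, y = x := by
          intro y
          obtain ⟨a, b, hab⟩ := hJ.2 x hx y (hJle y)
          have hax : a * x = x := by
            cases a with
            | one => exact one_mul _
            | coe a => rw [← WithOne.coe_mul, (hx0 a).2]
          have hxb : (x : WithOne S) * b = x := by
            cases b with
            | one => exact mul_one _
            | coe b => rw [← WithOne.coe_mul, (hx0 b).1]
          exact WithOne.coe_injective (by rw [hab, hax, hxb])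
        obtain ⟨y, z, hyz⟩ := hnt
        exact hyz ((hzero y).trans (hzero z).symm)
    · exact Set.eq_univ_of_univ_subset
        (hJgen.ge.trans (Set.union_subset_union_left _ (hmono h)))

theorem rank_eq_of_forall_le (hgen : gen = products ∨ gen = productsWithZero)
    (hJ : IsMaximalJClass J) (hJgen : gen J = Set.univ) {n : ℕ}
    (hex : ∃ A : Finset S, A.card ≤ n ∧ J ⊆ Subsemigroup.closure (A : Set S))
    (hle : ∀ A : Finset S, J ⊆ Subsemigroup.closure (A : Set S) → n ≤ A.card) :
    rank gen = n := by
  obtain ⟨A, hAn, hA⟩ := hex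
  have hAcard : A.card = n := le_antisymm hAn (hle A hA)
  refine le_antisymm (Nat.sInf_le ⟨A, hAcard, (gen_eq_univ_iff hgen hJ hJgen _).2 hA⟩) ?_
  refine le_csInf ⟨n, A, hAcard, (gen_eq_univ_iff hgen hJ hJgen _).2 hA⟩ ?_
  rintro _ ⟨C, rfl, hC⟩
  exact hle C ((gen_eq_univ_iff hgen hJ hJgen _).1 hC)

end Rank

/-! ### Two-generated noncyclic groups -/

section Group

theorem exists_closure_pair_of_rank_eq_two {G : Type*} [Group G] [Group.FG G]
    (h : Group.rank G = 2) :
    (∃ g h : G, Subgroup.closure {g, h} = ⊤) ∧ ¬ IsCyclic G := by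
  classical
  constructor
  · obtain ⟨A, hA, hAtop⟩ := Group.rank_spec G
    obtain ⟨g, k, -, rfl⟩ := Finset.card_eq_two.1 (hA.trans h)
    exact ⟨g, k, by simpa using hAtop⟩
  · rintro ⟨g, hg⟩
    have := Group.rank_le (G := G) (S := {g}) (by
      rw [Finset.coe_singleton, ← Subgroup.zpowers_eq_closure]
      exact (Subgroup.eq_top_iff' _).2 hg)
    rw [h, Finset.card_singleton] at this
    omega

theorem exists_closure_pair_perm_fin {r : ℕ} (hr : 3 ≤ r) :
    (∃ g h : Equiv.Perm (Fin r), Subgroup.closure {g, h} = ⊤) ∧ ¬ IsCyclic (Equiv.Perm (Fin r)) := by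
  constructor
  -- The generators are the full rotation and an adjacent transposition.
  · exact ⟨_, _, Equiv.Perm.closure_cycle_adjacent_swap (isCycle_finRotate_of_le (by omega))
      (support_finRotate_of_le (by omega)) ⟨0, by omega⟩⟩
  · intro h
    have hcomm := h.isMulCommutative.is_comm.comm
      (Equiv.swap (⟨0, by omega⟩ : Fin r) ⟨1, by omega⟩) (Equiv.swap ⟨1, by omega⟩ ⟨2, by omega⟩)
    have := congrArg (fun σ : Equiv.Perm (Fin r) => σ ⟨0, by omega⟩) hcomm
    simp [Equiv.swap_apply_def, Fin.ext_iff] at this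

theorem exists_closure_pair {G : Type*} [Group G] [Finite G]
    (h : Group.rank G = 2 ∨ ∃ r : ℕ, 3 ≤ r ∧ Nonempty (G ≃* Equiv.Perm (Fin r))) :
    (∃ g h : G, Subgroup.closure {g, h} = ⊤) ∧ ¬ IsCyclic G := by
  rcases h with h | ⟨r, hr, ⟨θ⟩⟩
  · exact exists_closure_pair_of_rank_eq_two h
  · obtain ⟨⟨g, k, hgk⟩, hcyc⟩ := exists_closure_pair_perm_fin hr
    refine ⟨⟨θ.symm g, θ.symm k, ?_⟩, fun h => hcyc (isCyclic_of_surjective θ θ.surjective)⟩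
    have := congrArg (Subgroup.map θ.symm.toMonoidHom) hgk
    rwa [MonoidHom.map_closure, Set.image_pair,
      Subgroup.map_top_of_surjective _ θ.symm.surjective] at this

end Group

end FiniteSemigroup

/-- `gen` is either of the two usual readings of `⟨ ⟩`; `G` is the maximal subgroup `H`
of `J` as an abstract group. -/
theorem theorem3p1 {S : Type*} [Semigroup S] [Finite S]
    (gen : Set S → Set S)
    (hgen : gen = FiniteSemigroup.products ∨ gen = FiniteSemigroup.productsWithZero)
    (J : Set S) (hJmax : FiniteSemigroup.IsMaximalJClass J)
    (hJreg : FiniteSemigroup.IsRegularSet J) (hJgen : gen J = Set.univ)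
    (H : Subsemigroup S) (hH : FiniteSemigroup.IsMaximalSubgroup H) (hHJ : (H : Set S) ⊆ J)
    {G : Type*} [Group G] [Finite G] (φ : G ≃* H)
    (i j : ℕ) (hi : i = (FiniteSemigroup.rClasses J).ncard)
    (hj : j = (FiniteSemigroup.lClasses J).ncard) :
    (Subsingleton G ∨ IsCyclic G → FiniteSemigroup.rank gen = max i j) ∧
    (Group.rank G = 2 ∨ (∃ r : ℕ, 3 ≤ r ∧ Nonempty (G ≃* Equiv.Perm (Fin r))) →
      ((i = j ∧ (∀ K ∈ FiniteSemigroup.rClasses J, FiniteSemigroup.HasUniqueIdempotent K) ∧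
          (∀ K ∈ FiniteSemigroup.lClasses J, FiniteSemigroup.HasUniqueIdempotent K)) →
        FiniteSemigroup.rank gen = max i j + 1) ∧
      (¬ (i = j ∧ (∀ K ∈ FiniteSemigroup.rClasses J, FiniteSemigroup.HasUniqueIdempotent K) ∧
          (∀ K ∈ FiniteSemigroup.lClasses J, FiniteSemigroup.HasUniqueIdempotent K)) →
        FiniteSemigroup.rank gen = max i j)) := by
  classical
  have hiR : (FiniteSemigroup.rClasses J).ncard ≤ max i j := hi ▸ le_max_left _ _
  have hjL : (FiniteSemigroup.lClasses J).ncard ≤ max i j := hj ▸ le_max_right _ _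
  have hlower : ∀ A : Finset S, J ⊆ Subsemigroup.closure (A : Set S) → max i j ≤ A.card := by
    intro A hA
    rw [hi, hj, ← Set.ncard_coe_finset]
    exact max_le (FiniteSemigroup.ncard_rClasses_le hJmax hA)
      (FiniteSemigroup.ncard_lClasses_le hJmax hA)
  refine ⟨fun hG => ?_, fun hG => ⟨fun hbrandt => ?_, fun hbrandt => ?_⟩⟩
  · obtain ⟨g, hg⟩ : IsCyclic G := hG.elim (fun _ => inferInstance) id
    obtain ⟨A, ψ, hcard, hψ, hA⟩ :=
      FiniteSemigroup.exists_generators hJmax hJreg hH hHJ φ hiR hjL g g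
    obtain ⟨hgT, -, hall⟩ := hA (Subsemigroup.closure A) Subsemigroup.subset_closure
    refine FiniteSemigroup.rank_eq_of_forall_le hgen hJmax hJgen ⟨A, hcard, hall ?_⟩ hlower
    refine FiniteSemigroup.forall_mem_of_closure_eq_top hψ (Set.singleton_nonempty g) ?_
      (by rintro x rfl; exact hgT)
    rw [← Subgroup.zpowers_eq_closure]
    exact (Subgroup.eq_top_iff' _).2 hg
  · obtain ⟨⟨g, h, hgh⟩, hcyc⟩ := FiniteSemigroup.exists_closure_pair hG
    obtain ⟨A, ψ, hcard, hψ, hA⟩ :=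
      FiniteSemigroup.exists_generators hJmax hJreg hH hHJ φ hiR hjL g h
    obtain ⟨hgT, -, hall⟩ := hA (Subsemigroup.closure (insert (ψ h) A : Finset S))
      (Subsemigroup.subset_closure.trans' (by simp))
    refine FiniteSemigroup.rank_eq_of_forall_le hgen hJmax hJgen
      ⟨insert (ψ h) A, (Finset.card_insert_le _ _).trans (by omega), hall ?_⟩ fun C hC => ?_
    · refine FiniteSemigroup.forall_mem_of_closure_eq_top hψ (Set.insert_nonempty g {h}) hgh ?_
      rintro x (rfl | rfl)
      · exact hgT
      · exact Subsemigroup.subset_closure (by simp)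
    -- With at most i = j generators the forced-path argument would make G cyclic.
    · refine Nat.succ_le_of_lt (lt_of_not_ge fun hle => hcyc ?_)
      refine FiniteSemigroup.isCyclic_of_ncard_le hJmax hJreg hH hHJ φ hbrandt.2 hC ?_
      rwa [Set.ncard_coe_finset, ← hi, show i = max i j by rw [← hbrandt.1, max_self]]
  · obtain ⟨⟨g, h, hgh⟩, -⟩ := FiniteSemigroup.exists_closure_pair hG
    obtain ⟨A, ψ, hcard, hψ, hA⟩ :=
      FiniteSemigroup.exists_generators hJmax hJreg hH hHJ φ hiR hjL g h
    obtain ⟨hgT, hhT, hall⟩ := hA (Subsemigroup.closure A) Subsemigroup.subset_closure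
    rw [← hi, ← hj] at hhT
    refine FiniteSemigroup.rank_eq_of_forall_le hgen hJmax hJgen ⟨A, hcard, hall ?_⟩ hlower
    refine FiniteSemigroup.forall_mem_of_closure_eq_top hψ (Set.insert_nonempty g {h}) hgh ?_
    rintro x (rfl | rfl)
    · exact hgT
    · exact hhT hbrandt
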